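/- Let $\mathbb{K}$ be an algebraically closed field of characteristic zero and let $X\subset\mathbb{A}^n$ be a Zariski closed subset (an affine variety, not necessarily irreducible). For $s\ge 0$ let $\Sigma_s\subset\mathrm{Aut}(X)$ be the set of all automorphisms $\alpha$ of $X$ such that the components of $\alpha$ and of $\alpha^{-1}$ are restrictions to $X$ of polynomials of degree at most $s$. Via the components of $\alpha$ and $\alpha^{-1}$, $\Sigma_s$ embeds in a finite-dimensional vector space; it carries the induced Zariski topology. The ind-Zariski topology on $\mathrm{Aut}(X)=\bigcup_s\Sigma_s$ is the one in which a set is closed iff its intersection with every $\Sigma_s$ is closed in $\Sigma_s$. An algebraic subgroup of $\mathrm{Aut}(X)$ is a subgroup that is contained in some $\Sigma_s$ and is closed there; it is connected if it is connected in the Zariski topology of $\Sigma_s$. A subgroup $G\subset\mathrm{Aut}(X)$ is algebraically generated if it is generated by a (possibly infinite) family of connected algebraic subgroups of $\mathrm{Aut}(X)$. A group $H$ of automorphisms acts $m$-transitively on $O\subset X$ if for any two $m$-tuples $(P_1,\dots,P_m)$, $(Q_1,\dots,Q_m)$, each consisting of pairwise distinct points of $O$, there is $h\in H$ with $h(P_i)=Q_i$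 for all $i$; it acts infinitely transitively on $O$ if it does so $m$-transitively for every $m\ge1$. Let $G\subset\mathrm{Aut}(X)$ be an algebraically generated subgroup, and let $\overline{G}$ be either the closure of $G$ in the ind-Zariski topology or the union over $s$ of the Zariski closures of $G\cap\Sigma_s$ in $\Sigma_s$ (both are subgroups of $\mathrm{Aut}(X)$, and the statement holds for each of them). Then the following hold. (a) The orbits of $G$ and of $\overline{G}$ in $X$ are the same: $G.x=\overline{G}.x$ for every $x\in X$. In particular, a subset $O\subset X$ is an open orbit of $\overline{G}$ if and only if it is an open orbit of $G$; that is, if $\overline{G}$ acts on $X$ with an open orbit $\mathscr{O}_{\overline{G}}$, then so does $G$, and $\mathscr{O}_G=\mathscr{O}_{\overline{G}}$. (b) Let $m\ge1$. If $\overline{G}$ acts $m$-transitively on an open orbit $\mathscr{O}_{\overline{G}}$, then so does $G$. (c) If $\overline{G}$ acts infinitely transitively on an open orbit $\mathscr{O}_{\overline{G}}$, then so does $G$. -/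

import Mathlib

open scoped Topology

namespace AffAut

section Zariski

variable (K : Type*) [Field K] (V : Type*) [AddCommGroup V] [Module K V]

/-- The algebra of polynomial functions on a `K`-vector space: the algebra of functions
generated by the linear forms. -/
def polyFun : Subalgebra K (V → K) :=
  Algebra.adjoin K (Set.range fun (l : Module.Dual K V) (v : V) => l v)

/-- The common zero set of a set of functions. -/
def zeros {K T : Type*} [Field K] (S : Set (T → K)) : Set T := {v | ∀ f ∈ S, f v = 0}

/-- The Zariski topology on a vector space: the closed sets are the common zero sets of
polynomial functions. -/
@[reducible]
def zariskiTopology : TopologicalSpace V :=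
  TopologicalSpace.ofClosed {Z | ∃ S : Set (V → K), S ⊆ polyFun K V ∧ Z = zeros S}
    ⟨{1}, by simp, by ext; simp [zeros]⟩
    (by
      intro A hA
      choose! S hS hZ using fun Z (hZ : Z ∈ A) => hA hZ
      refine ⟨⋃ Z ∈ A, S Z, by simpa using hS, ?_⟩
      ext v
      simp only [Set.mem_sInter, zeros, Set.mem_iUnion, Set.mem_ofPred_eq]
      constructor
      · rintro h f ⟨Z, hZA, hf⟩
        have := h Z hZA
        rw [hZ Z hZA] at this
        exact this f hf
      · intro h Z hZA
        rw [hZ Z hZA]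
        exact fun f hf => h f ⟨Z, hZA, hf⟩)
    (by
      rintro _ ⟨S, hS, rfl⟩ _ ⟨T, hT, rfl⟩
      refine ⟨{h | ∃ f ∈ S, ∃ g ∈ T, h = f * g}, ?_, ?_⟩
      · rintro _ ⟨f, hf, g, hg, rfl⟩
        exact mul_mem (hS hf) (hT hg)
      · ext v
        simp only [zeros, Set.mem_union, Set.mem_ofPred_eq]
        constructor
        · rintro (h | h) _ ⟨f, hf, g, hg, rfl⟩
          · simp [h f hf]
          · simp [h g hg]
        · intro h
          by_contra! hcon
          obtain ⟨⟨f, hf, hf0⟩, g, hg, hg0⟩ := hcon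
          have := h _ ⟨f, hf, g, hg, rfl⟩
          simp [hf0, hg0] at this)

variable {K V}

theorem isClosed_zariski_iff {Z : Set V} :
    IsClosed[zariskiTopology K V] Z ↔ ∃ S : Set (V → K), S ⊆ polyFun K V ∧ Z = zeros S := by
  rw [← @isOpen_compl_iff _ _ (zariskiTopology K V)]
  change Zᶜᶜ ∈ {Z | ∃ S : Set (V → K), S ⊆ polyFun K V ∧ Z = zeros S} ↔ _
  rw [compl_compl]
  rfl

end Zariski

variable {K : Type*} [Field K] {n : ℕ} (X : Set (Fin n → K))

/-- The subspace topology on `X ⊆ 𝔸ⁿ` of the Zariski topology. -/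
@[reducible]
def varietyTopology : TopologicalSpace X :=
  (zariskiTopology K (Fin n → K)).induced Subtype.val

/-- Restriction of polynomials to functions on `X`; its range is the algebra of regular
functions on the closed set `X`. -/
noncomputable def restr : MvPolynomial (Fin n) K →ₐ[K] (X → K) :=
  MvPolynomial.aeval fun i (x : X) => x.1 i

/-- The space of regular functions on `X` of degree at most `s`, i.e. those which are
restrictions of polynomials of total degree at most `s`. -/
noncomputable def regLE (s : ℕ) : Submodule K (X → K) :=
  (MvPolynomial.restrictTotalDegree (Fin n) K s).map (restr X).toLinearMap

variable {X}

/-- The `i`-th component of a self-map of `X`. -/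
def comp (f : X → X) (i : Fin n) : X → K := fun x => (f x).1 i

/-- A self-map of `X` is a morphism if its components are regular functions. -/
def IsMorphism (f : X → X) : Prop := ∀ i, comp f i ∈ (restr X).range

theorem restr_apply (p : MvPolynomial (Fin n) K) (x : X) :
    restr X p x = MvPolynomial.eval x.1 p := by
  induction p using MvPolynomial.induction_on with
  | C a => simp [restr]
  | add p q hp hq => simp [hp, hq]
  | mul_X p i hp => rw [map_mul, map_mul, Pi.mul_apply, hp]; simp [restr]

theorem restr_comp (p : MvPolynomial (Fin n) K) (q : Fin n → MvPolynomial (Fin n) K)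
    (f : X → X) (hf : ∀ i, restr X (q i) = comp f i) (x : X) :
    restr X p (f x) = restr X (MvPolynomial.aeval q p) x := by
  induction p using MvPolynomial.induction_on with
  | C a => simp [restr]
  | add p q hp hq => simp [hp, hq]
  | mul_X p i hp =>
    rw [map_mul, map_mul, map_mul, Pi.mul_apply, Pi.mul_apply, hp, MvPolynomial.aeval_X, hf]
    simp [restr, comp]

theorem IsMorphism.comp {f g : X → X} (hf : IsMorphism f) (hg : IsMorphism g) :
    IsMorphism (f ∘ g) := by
  intro i
  obtain ⟨p, hp⟩ := hf i
  choose q hq using hg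
  exact ⟨MvPolynomial.aeval q p, funext fun x =>
    (restr_comp p q g hq x).symm.trans (congrFun hp (g x))⟩

theorem IsMorphism.id : IsMorphism (fun x : X => x) :=
  fun i => ⟨MvPolynomial.X i, by ext x; simp [restr, AffAut.comp]⟩

variable (X)

/-- The automorphism group `Aut(X)` of the affine variety `X`. -/
def Aut : Subgroup (Equiv.Perm X) where
  carrier := {α | IsMorphism (α : X → X) ∧ IsMorphism (α⁻¹ : Equiv.Perm X)}
  mul_mem' := by
    rintro a b ⟨ha, ha'⟩ ⟨hb, hb'⟩
    refine ⟨ha.comp hb, ?_⟩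
    rw [mul_inv_rev]
    exact hb'.comp ha'
  one_mem' := ⟨IsMorphism.id, by rw [inv_one]; exact IsMorphism.id⟩
  inv_mem' := by
    rintro a ⟨ha, ha'⟩
    exact ⟨ha', by rwa [inv_inv]⟩

/-- The set `Σ_s` of automorphisms `α` such that `α` and `α⁻¹` have degree at most `s`. -/
def stratum (s : ℕ) : Set (Aut X) :=
  {α | ∀ i, comp (fun x => α • x) i ∈ regLE X s ∧ comp (fun x => α⁻¹ • x) i ∈ regLE X s}

/-- The affine space (a finite-dimensional vector space) in which `Σ_s` is embedded. -/
abbrev Ambient (s : ℕ) : Type _ := (Fin n → regLE X s) × (Fin n → regLE X s)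

/-- The embedding of `Σ_s` sending `α` to the components of `α` and of `α⁻¹`. -/
noncomputable def coords (s : ℕ) (α : stratum X s) : Ambient X s :=
  (fun i => ⟨_, (α.2 i).1⟩, fun i => ⟨_, (α.2 i).2⟩)

/-- The Zariski topology of the affine variety `Σ_s`. -/
@[reducible]
noncomputable def stratumTopology (s : ℕ) : TopologicalSpace (stratum X s) :=
  (zariskiTopology K (Ambient X s)).induced (coords X s)

/-- The ind-Zariski topology on `Aut(X)`, the inductive limit of the topologies of the `Σ_s`:
a set is closed iff its intersection with each `Σ_s` is Zariski closed in `Σ_s`. -/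
@[reducible]
noncomputable def indTopology : TopologicalSpace (Aut X) :=
  ⨆ s, (stratumTopology X s).coinduced Subtype.val

variable {X}

theorem isClosed_ind_iff {Z : Set (Aut X)} :
    IsClosed[indTopology X] Z ↔
      ∀ s, IsClosed[stratumTopology X s] (Subtype.val ⁻¹' Z : Set (stratum X s)) := by
  simp only [isClosed_iSup_iff, isClosed_coinduced]

/-- The closure of a subset `F ⊆ Aut(X)` in the ind-Zariski topology. -/
def indClosureSet (F : Set (Aut X)) : Set (Aut X) := @closure _ (indTopology X) F

/-- The union over `s` of the Zariski closures of `F ∩ Σ_s` in `Σ_s`. -/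
def limClosureSet (F : Set (Aut X)) : Set (Aut X) :=
  ⋃ s, Subtype.val '' (@closure _ (stratumTopology X s) (Subtype.val ⁻¹' F))

/-! ### Both closures of a subgroup are subgroups -/

theorem regLE_mono {s t : ℕ} (h : s ≤ t) : regLE X s ≤ regLE X t := by
  refine Submodule.map_mono fun p hp => ?_
  rw [MvPolynomial.mem_restrictTotalDegree] at *
  omega

theorem exists_mem_stratum (α : Aut X) : ∃ s, α ∈ stratum X s := by
  choose p hp using α.2.1
  choose q hq using α.2.2
  refine ⟨Finset.univ.sup (fun i => (p i).totalDegree) +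
    Finset.univ.sup (fun i => (q i).totalDegree), fun i => ⟨⟨p i, ?_, hp i⟩, ⟨q i, ?_, hq i⟩⟩⟩
  · rw [SetLike.mem_coe, MvPolynomial.mem_restrictTotalDegree]
    exact (Finset.le_sup (f := fun i => (p i).totalDegree) (Finset.mem_univ i)).trans
      (Nat.le_add_right _ _)
  · rw [SetLike.mem_coe, MvPolynomial.mem_restrictTotalDegree]
    exact (Finset.le_sup (f := fun i => (q i).totalDegree) (Finset.mem_univ i)).trans
      (Nat.le_add_left _ _)

theorem totalDegree_aeval_le {r s : ℕ} (p : MvPolynomial (Fin n) K)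
    (q : Fin n → MvPolynomial (Fin n) K) (hp : p.totalDegree ≤ r)
    (hq : ∀ i, (q i).totalDegree ≤ s) : (MvPolynomial.aeval q p).totalDegree ≤ r * s := by
  rw [MvPolynomial.aeval_def, MvPolynomial.eval₂_eq']
  refine MvPolynomial.totalDegree_finsetSum_le fun d hd => ?_
  refine (MvPolynomial.totalDegree_mul _ _).trans ?_
  rw [MvPolynomial.algebraMap_eq, MvPolynomial.totalDegree_C, zero_add]
  refine (MvPolynomial.totalDegree_finsetProd _ _).trans ?_
  calc ∑ i, (q i ^ d i).totalDegree ≤ ∑ i, d i * s := Finset.sum_le_sum fun i _ =>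
        (MvPolynomial.totalDegree_pow _ _).trans (Nat.mul_le_mul_left _ (hq i))
    _ = (∑ i, d i) * s := by rw [Finset.sum_mul]
    _ ≤ r * s := Nat.mul_le_mul_right _ (le_trans (by
        have := MvPolynomial.le_totalDegree hd
        rwa [Finsupp.sum_fintype _ _ (fun _ => rfl)] at this) hp)

theorem comp_mem_regLE {r s : ℕ} {f g : X → X} (hf : ∀ i, comp f i ∈ regLE X r)
    (hg : ∀ i, comp g i ∈ regLE X s) (i : Fin n) : comp (fun x => f (g x)) i ∈ regLE X (r * s) := by
  obtain ⟨p, hp, hpf⟩ := hf i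
  choose q hq hqg using hg
  simp only [SetLike.mem_coe, MvPolynomial.mem_restrictTotalDegree] at hp hq
  refine ⟨MvPolynomial.aeval q p, ?_, funext fun x =>
    (restr_comp p q g hqg x).symm.trans (congrFun hpf (g x))⟩
  rw [SetLike.mem_coe, MvPolynomial.mem_restrictTotalDegree]
  exact totalDegree_aeval_le p q hp hq

theorem mul_mem_stratum {r s : ℕ} {α β : Aut X} (hα : α ∈ stratum X r) (hβ : β ∈ stratum X s) :
    α * β ∈ stratum X (r * s) := by
  intro i
  constructor
  · simpa only [mul_smul] using
      comp_mem_regLE (fun i => (hα i).1) (fun i => (hβ i).1) i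
  · have := comp_mem_regLE (fun i => (hβ i).2) (fun i => (hα i).2) i
    rw [mul_comm r s]
    simpa only [mul_inv_rev, mul_smul] using this

theorem inv_mem_stratum {s : ℕ} {α : Aut X} (hα : α ∈ stratum X s) : α⁻¹ ∈ stratum X s :=
  fun i => ⟨(hα i).2, by rw [inv_inv]; exact (hα i).1⟩

/-- The regular functions on `Σ_s`: restrictions of polynomial functions on the ambient space. -/
def stratumFun (s : ℕ) : Set (stratum X s → K) :=
  {φ | ∃ f ∈ polyFun K (Ambient X s), φ = fun α => f (coords X s α)}

theorem isClosed_zeros_stratum {s : ℕ} {S : Set (stratum X s → K)} (hS : S ⊆ stratumFun s) :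
    IsClosed[stratumTopology X s] (zeros S) := by
  choose! F hF hFS using hS
  refine (@isClosed_induced_iff _ _ (zariskiTopology K (Ambient X s)) _ _).2
    ⟨zeros (F '' S), isClosed_zariski_iff.2 ⟨F '' S, ?_, rfl⟩, ?_⟩
  · rintro _ ⟨φ, hφ, rfl⟩
    exact hF hφ
  · ext α
    simp only [zeros, Set.mem_preimage, Set.mem_ofPred_eq, Set.forall_mem_image]
    refine forall₂_congr fun φ hφ => ?_
    rw [congrFun (hFS hφ) α]

theorem exists_zeros_of_isClosed {s : ℕ} {Z : Set (stratum X s)}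
    (hZ : IsClosed[stratumTopology X s] Z) :
    ∃ S : Set (Ambient X s → K), S ⊆ polyFun K (Ambient X s) ∧
      ∀ α, α ∈ Z ↔ ∀ f ∈ S, f (coords X s α) = 0 := by
  obtain ⟨C, hC, rfl⟩ := (@isClosed_induced_iff _ _ (zariskiTopology K (Ambient X s)) _ _).1 hZ
  obtain ⟨S, hS, rfl⟩ := isClosed_zariski_iff.1 hC
  exact ⟨S, hS, fun α => Iff.rfl⟩

instance (s : ℕ) : FiniteDimensional K (regLE X s) :=
  inferInstanceAs (Module.Finite K
    ((MvPolynomial.restrictTotalDegree (Fin n) K s).map (restr X).toLinearMap))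

/-- Evaluation of the `i`-th component of the first (`b = true`) or second map at `x`. -/
def evalForm (s : ℕ) (b : Bool) (x : X) (i : Fin n) : Module.Dual K (Ambient X s) where
  toFun v := if b then (v.1 i).1 x else (v.2 i).1 x
  map_add' u v := by cases b <;> simp
  map_smul' c v := by cases b <;> simp

theorem span_evalForm (s : ℕ) :
    Submodule.span K (Set.range fun t : Bool × X × Fin n => evalForm s t.1 t.2.1 t.2.2) = ⊤ := by
  rw [← Subspace.dualCoannihilator_dualAnnihilator_eq (K := K)
    (W := Submodule.span K (Set.range fun t : Bool × X × Fin n => evalForm s t.1 t.2.1 t.2.2))]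
  suffices h : (Submodule.span K (Set.range fun t : Bool × X × Fin n =>
      evalForm s t.1 t.2.1 t.2.2)).dualCoannihilator = ⊥ by
    rw [h, Submodule.dualAnnihilator_bot]
  rw [eq_bot_iff]
  intro v hv
  rw [Submodule.mem_dualCoannihilator] at hv
  have key : ∀ b x i, evalForm s b x i v = 0 := fun b x i =>
    hv _ (Submodule.subset_span ⟨(b, x, i), rfl⟩)
  rw [Submodule.mem_bot]
  refine Prod.ext (funext fun i => Subtype.ext (funext fun x => ?_))
    (funext fun i => Subtype.ext (funext fun x => ?_))
  · simpa [evalForm] using key true x i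
  · simpa [evalForm] using key false x i

/-- A map between strata is continuous if the evaluations of the image are regular. -/
theorem continuous_of_eval {s t : ℕ} (T : stratum X s → stratum X t)
    (h1 : ∀ x i, (fun α => ((T α).1 • x : X).1 i) ∈ stratumFun (X := X) s)
    (h2 : ∀ x i, (fun α => ((T α).1⁻¹ • x : X).1 i) ∈ stratumFun (X := X) s) :
    @Continuous _ _ (stratumTopology X s) (stratumTopology X t) T := by
  have hl : ∀ l : Module.Dual K (Ambient X t),
      (fun α => l (coords X t (T α))) ∈ stratumFun (X := X) s := by
    intro l
    have : l ∈ Submodule.span K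
        (Set.range fun u : Bool × X × Fin n => evalForm t u.1 u.2.1 u.2.2) := by
      rw [span_evalForm]; trivial
    induction this using Submodule.span_induction with
    | mem l hl =>
      obtain ⟨⟨b, x, i⟩, rfl⟩ := hl
      cases b
      · exact h2 x i
      · exact h1 x i
    | zero => exact ⟨0, zero_mem _, rfl⟩
    | add l m _ _ hl hm =>
      obtain ⟨f, hf, hfl⟩ := hl
      obtain ⟨g, hg, hgm⟩ := hm
      refine ⟨f + g, add_mem hf hg, funext fun α => ?_⟩
      simpa using congrArg₂ (· + ·) (congrFun hfl α) (congrFun hgm α)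
    | smul c l _ hl =>
      obtain ⟨f, hf, hfl⟩ := hl
      refine ⟨c • f, Subalgebra.smul_mem _ hf c, funext fun α => ?_⟩
      simpa using congrArg (c * ·) (congrFun hfl α)
  have hp : ∀ f ∈ polyFun K (Ambient X t),
      (fun α => f (coords X t (T α))) ∈ stratumFun (X := X) s := by
    intro f hf
    induction hf using Algebra.adjoin_induction with
    | mem f hf => obtain ⟨l, rfl⟩ := hf; exact hl l
    | algebraMap c => exact ⟨algebraMap K _ c, Subalgebra.algebraMap_mem _ c, rfl⟩
    | add f g _ _ hf hg =>
      obtain ⟨f', hf', hff⟩ := hf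
      obtain ⟨g', hg', hgg⟩ := hg
      exact ⟨f' + g', add_mem hf' hg', funext fun α =>
        congrArg₂ (· + ·) (congrFun hff α) (congrFun hgg α)⟩
    | mul f g _ _ hf hg =>
      obtain ⟨f', hf', hff⟩ := hf
      obtain ⟨g', hg', hgg⟩ := hg
      exact ⟨f' * g', mul_mem hf' hg', funext fun α =>
        congrArg₂ (· * ·) (congrFun hff α) (congrFun hgg α)⟩
  rw [@continuous_iff_isClosed _ _ (stratumTopology X s) (stratumTopology X t)]
  intro Z hZ
  obtain ⟨S, hS, hSZ⟩ := exists_zeros_of_isClosed hZ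
  have : T ⁻¹' Z = zeros ((fun f α => f (coords X t (T α))) '' S) := by
    ext α
    simp only [Set.mem_preimage, hSZ, zeros, Set.forall_mem_image, Set.mem_ofPred_eq]
  rw [this]
  refine isClosed_zeros_stratum ?_
  rintro _ ⟨f, hf, rfl⟩
  exact hp f (hS hf)

theorem eval_mem (s : ℕ) (x : X) (i : Fin n) :
    (fun α : stratum X s => (α.1 • x : X).1 i) ∈ stratumFun (X := X) s :=
  ⟨evalForm s true x i, Algebra.subset_adjoin ⟨evalForm s true x i, rfl⟩, rfl⟩

theorem eval_inv_mem (s : ℕ) (x : X) (i : Fin n) :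
    (fun α : stratum X s => (α.1⁻¹ • x : X).1 i) ∈ stratumFun (X := X) s :=
  ⟨evalForm s false x i, Algebra.subset_adjoin ⟨evalForm s false x i, rfl⟩, rfl⟩

/-- Polynomials in regular functions are regular. -/
theorem poly_mem {s : ℕ} (u : stratum X s → X)
    (hu : ∀ i, (fun α => (u α).1 i) ∈ stratumFun (X := X) s) (p : MvPolynomial (Fin n) K) :
    (fun α => restr X p (u α)) ∈ stratumFun (X := X) s := by
  choose f hf hfu using hu
  refine ⟨MvPolynomial.aeval f p, ?_, funext fun α => ?_⟩
  · have h : MvPolynomial.aeval f p ∈ Algebra.adjoin K (Set.range f) := by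
      rw [Algebra.adjoin_range_eq_range_aeval]
      exact ⟨p, rfl⟩
    exact Algebra.adjoin_le (by rintro _ ⟨i, rfl⟩; exact hf i) h
  · induction p using MvPolynomial.induction_on with
    | C a => simp [restr]
    | add p q hp hq => simp [hp, hq]
    | mul_X p i hp =>
      rw [map_mul, map_mul, Pi.mul_apply, Pi.mul_apply, hp, MvPolynomial.aeval_X,
        ← congrFun (hfu i) α]
      simp [restr]

theorem continuous_mul_left {r s : ℕ} (g : stratum X r) :
    @Continuous _ _ (stratumTopology X s) (stratumTopology X (r * s))
      fun α => ⟨g.1 * α.1, mul_mem_stratum g.2 α.2⟩ := by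
  refine continuous_of_eval _ (fun x i => ?_) (fun x i => ?_)
  · obtain ⟨p, hp⟩ := g.1.2.1 i
    have := poly_mem (fun α : stratum X s => α.1 • x) (eval_mem s x) p
    rwa [show restr X p = _ from hp] at this
  · simpa only [mul_inv_rev, mul_smul] using eval_inv_mem s (g.1⁻¹ • x) i

theorem continuous_mul_right {r s : ℕ} (g : stratum X s) :
    @Continuous _ _ (stratumTopology X r) (stratumTopology X (r * s))
      fun α => ⟨α.1 * g.1, mul_mem_stratum α.2 g.2⟩ := by
  refine continuous_of_eval _ (fun x i => ?_) (fun x i => ?_)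
  · simpa only [mul_smul] using eval_mem r (g.1 • x) i
  · obtain ⟨p, hp⟩ := g.1.2.2 i
    have := poly_mem (fun α : stratum X r => α.1⁻¹ • x) (eval_inv_mem r x) p
    rw [show restr X p = _ from hp] at this
    simp only [mul_inv_rev, mul_smul]
    exact this

theorem continuous_inv (s : ℕ) :
    @Continuous _ _ (stratumTopology X s) (stratumTopology X s)
      fun α => ⟨α.1⁻¹, inv_mem_stratum α.2⟩ := by
  refine continuous_of_eval _ (fun x i => eval_inv_mem s x i) (fun x i => ?_)
  simpa only [inv_inv] using eval_mem s x i

/-- A self-map of `Aut(X)` which restricts to continuous maps between strata is continuous. -/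
theorem continuous_ind (T : Aut X → Aut X) (h : ∀ s, ∃ t, ∃ hT : ∀ α ∈ stratum X s,
    T α ∈ stratum X t, @Continuous _ _ (stratumTopology X s) (stratumTopology X t)
      fun α => ⟨T α.1, hT _ α.2⟩) :
    @Continuous _ _ (indTopology X) (indTopology X) T := by
  rw [@continuous_iff_isClosed _ _ (indTopology X) (indTopology X)]
  intro Z hZ
  rw [isClosed_ind_iff] at hZ ⊢
  intro s
  obtain ⟨t, hT, hc⟩ := h s
  exact @IsClosed.preimage _ _ (stratumTopology X s) (stratumTopology X t) _ hc _ (hZ t)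

theorem continuous_ind_mul_left (g : Aut X) :
    @Continuous _ _ (indTopology X) (indTopology X) fun α => g * α := by
  obtain ⟨r, hr⟩ := exists_mem_stratum g
  exact continuous_ind _ fun s => ⟨r * s, fun _ hα => mul_mem_stratum hr hα,
    continuous_mul_left ⟨g, hr⟩⟩

theorem continuous_ind_mul_right (g : Aut X) :
    @Continuous _ _ (indTopology X) (indTopology X) fun α => α * g := by
  obtain ⟨r, hr⟩ := exists_mem_stratum g
  exact continuous_ind _ fun s => ⟨s * r, fun _ hα => mul_mem_stratum hα hr,
    continuous_mul_right ⟨g, hr⟩⟩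

theorem continuous_ind_inv :
    @Continuous _ _ (indTopology X) (indTopology X) fun α : Aut X => α⁻¹ :=
  continuous_ind _ fun s => ⟨s, fun _ hα => inv_mem_stratum hα, continuous_inv s⟩

/-- The closure of a subgroup of `Aut(X)` in the ind-Zariski topology. -/
def indClosure (G : Subgroup (Aut X)) : Subgroup (Aut X) where
  carrier := indClosureSet (G : Set (Aut X))
  mul_mem' := by
    let _ := indTopology X
    intro a b ha hb
    have h1 : ∀ g ∈ G, ∀ b ∈ closure (G : Set (Aut X)), g * b ∈ closure (G : Set (Aut X)) :=
      fun g hg b hb => map_mem_closure (continuous_ind_mul_left g) hb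
        fun c hc => G.mul_mem hg hc
    have h2 := map_mem_closure (continuous_ind_mul_right b) (t := closure (G : Set (Aut X)))
      (show a ∈ closure (G : Set (Aut X)) from ha) fun c hc => h1 c hc b hb
    rwa [closure_closure] at h2
  one_mem' := by
    exact @subset_closure _ (indTopology X) _ _ G.one_mem
  inv_mem' := by
    let _ := indTopology X
    intro a ha
    exact map_mem_closure continuous_ind_inv ha fun c hc => G.inv_mem hc

theorem subset_limClosureSet (F : Set (Aut X)) : F ⊆ limClosureSet F := fun a ha => by
  obtain ⟨s, hs⟩ := exists_mem_stratum a
  exact Set.mem_iUnion.2 ⟨s, ⟨a, hs⟩, @subset_closure _ (stratumTopology X s) _ _ ha, rfl⟩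

/-- The union of the Zariski closures of the `G ∩ Σ_s` in `Σ_s`, for a subgroup `G`. -/
def limClosure (G : Subgroup (Aut X)) : Subgroup (Aut X) where
  carrier := limClosureSet (G : Set (Aut X))
  mul_mem' := by
    intro a b ha hb
    obtain ⟨r, ⟨a, har⟩, hac, rfl⟩ := Set.mem_iUnion.1 ha
    obtain ⟨s, ⟨b, hbs⟩, hbc, rfl⟩ := Set.mem_iUnion.1 hb
    refine Set.mem_iUnion.2 ⟨r * s, ⟨a * b, mul_mem_stratum har hbs⟩, ?_, rfl⟩
    have h1 : ∀ g : stratum X r, g.1 ∈ G → (⟨g.1 * b, mul_mem_stratum g.2 hbs⟩ :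
        stratum X (r * s)) ∈ @closure _ (stratumTopology X (r * s))
          (Subtype.val ⁻¹' (G : Set (Aut X))) := fun g hg =>
      @map_mem_closure _ _ (stratumTopology X s) (stratumTopology X (r * s)) _ _ ⟨b, hbs⟩ _
        (continuous_mul_left g) hbc fun c hc => G.mul_mem hg hc
    have h2 := @map_mem_closure _ _ (stratumTopology X r) (stratumTopology X (r * s)) _ _ _ _
      (continuous_mul_right ⟨b, hbs⟩) hac fun c hc => h1 c hc
    rwa [@closure_closure _ (stratumTopology X (r * s))] at h2
  one_mem' := subset_limClosureSet _ G.one_mem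
  inv_mem' := by
    intro a ha
    obtain ⟨s, ⟨a, has⟩, hac, rfl⟩ := Set.mem_iUnion.1 ha
    exact Set.mem_iUnion.2 ⟨s, ⟨a⁻¹, inv_mem_stratum has⟩,
      @map_mem_closure _ _ (stratumTopology X s) (stratumTopology X s) _ _ ⟨a, has⟩ _
        (continuous_inv s) hac fun c hc => G.inv_mem hc, rfl⟩

/-! ### Algebraically generated groups, open orbits, multiple transitivity -/

/-- A connected algebraic subgroup of `Aut(X)`: a subgroup which is contained in some `Σ_s`,
and is Zariski closed and connected there. -/
def IsConnectedAlgebraic (H : Subgroup (Aut X)) : Prop :=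
  ∃ s, (H : Set (Aut X)) ⊆ stratum X s ∧
    IsClosed[stratumTopology X s] (Subtype.val ⁻¹' (H : Set (Aut X))) ∧
    @IsConnected _ (stratumTopology X s) (Subtype.val ⁻¹' (H : Set (Aut X)))

/-- `G` is generated by a family of connected algebraic subgroups. -/
def IsAlgebraicallyGenerated (G : Subgroup (Aut X)) : Prop :=
  ∃ 𝓕 : Set (Subgroup (Aut X)), (∀ H ∈ 𝓕, IsConnectedAlgebraic H) ∧ G = sSup 𝓕

/-- `O` is an orbit of `G` in `X` and is Zariski open in `X`. -/
def IsOpenOrbit (G : Subgroup (Aut X)) (O : Set X) : Prop :=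
  IsOpen[varietyTopology X] O ∧ ∃ x : X, O = MulAction.orbit G x

/-- `G` acts `m`-transitively on `O ⊆ X`: any `m`-tuple of distinct points of `O` can be moved
by an element of `G` to any other such `m`-tuple. -/
def IsMTransitiveOn (G : Subgroup (Aut X)) (m : ℕ) (O : Set X) : Prop :=
  ∀ P Q : Fin m → X, Function.Injective P → Function.Injective Q →
    (∀ i, P i ∈ O) → (∀ i, Q i ∈ O) → ∃ g ∈ G, ∀ i, g • P i = Q i

/-- `G` acts infinitely transitively on `O`. -/
def IsInfTransitiveOn (G : Subgroup (Aut X)) (O : Set X) : Prop :=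
  ∀ m, 1 ≤ m → IsMTransitiveOn G m O

end AffAut

/-! ### Constructible sets and points of finitely generated algebras -/

/-! Everything follows from one fact about the diagonal action on `m`-tuples: for every tuple `P`,
`G` and its closure have the same orbit through `P` (`smul_mem_orbit_of_mem_indClosure`). Taking `m
= 1` compares orbits in `X`; general `m` transfers transitivity.

The fact rests on orbits of `G` being large in their closures (`exists_open_subset_orbit`). A set
`H₁ ⋯ H_N . P`, with the `H_i` among the generating connected algebraic groups, is the image of an
affine variety and has a prime vanishing ideal. If that ideal has minimal height, a further factor
cannot enlarge the Zariski closure, so this closure is stable under `G` and equals that of `G.P`.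
Chevalley's theorem then yields a nonempty open subset of the closure inside `G.P`.

Now let `α` lie in the closure of `G`. Being in the closure of `G.P` is a closed condition on
automorphisms, so it passes from `G` to its closure. Hence `G.(αP)` lies in the closure of `G.P`,
and applying this to `α⁻¹` shows that both orbits have the same closure. The dense set `G.(αP)`
meets the open subset contained in `G.P`, so the two orbits coincide.

Two inputs concern a connected algebraic group `H`. It is an affine variety: the characters of its
function algebra are its points (`isAffineAlgebra_groupAlgebra`). It is irreducible: that algebra
has no zero divisors (`groupAlgebra_eq_zero_or_eq_zero`). -/

theorem Topology.IsConstructible.exists_isOpen_inter_closure {S : Type*} [TopologicalSpace S]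
    {s : Set S} (hs : IsConstructible s) (x : S) :
    ∃ U, IsOpen U ∧ x ∈ U ∧ (U ∩ closure {x} ⊆ s ∨ U ∩ closure {x} ⊆ sᶜ) := by
  -- The dichotomy is symmetric in `s` and its complement, which is why it survives complements as
  -- well as unions.
  induction hs using IsConstructible.empty_union_induction with
  | open_retrocompact U hU _ =>
    by_cases hx : x ∈ U
    · exact ⟨U, hU, hx, Or.inl Set.inter_subset_left⟩
    · refine ⟨Set.univ, isOpen_univ, trivial, Or.inr ?_⟩
      rw [Set.univ_inter]
      exact closure_minimal (by simpa using hx) hU.isClosed_compl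
  | union s _ t _ hs ht =>
    obtain ⟨U, hU, hxU, hUs⟩ := hs
    obtain ⟨V, hV, hxV, hVt⟩ := ht
    refine ⟨U ∩ V, hU.inter hV, ⟨hxU, hxV⟩, ?_⟩
    rcases hUs with hUs | hUs
    · exact Or.inl fun y hy => Or.inl (hUs ⟨hy.1.1, hy.2⟩)
    rcases hVt with hVt | hVt
    · exact Or.inl fun y hy => Or.inr (hVt ⟨hy.1.2, hy.2⟩)
    · exact Or.inr fun y hy h => h.elim (hUs ⟨hy.1.1, hy.2⟩) (hVt ⟨hy.1.2, hy.2⟩)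
  | compl s _ hs =>
    obtain ⟨U, hU, hxU, h⟩ := hs
    exact ⟨U, hU, hxU, by rwa [compl_compl, or_comm]⟩

/-- A finitely generated algebra over an algebraically closed field has, over each of its prime
ideals, a point with values in the field. -/
theorem exists_algHom_of_isPrime {K A : Type*} [Field K] [IsAlgClosed K] [CommRing A]
    [Algebra K A] [Algebra.FiniteType K A] (q : Ideal A) [q.IsPrime] :
    ∃ χ : A →ₐ[K] K, ∀ a ∈ q, χ a = 0 := by
  obtain ⟨M, hM, hqM⟩ := q.exists_le_maximal (Ideal.IsPrime.ne_top ‹_›)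
  let := Ideal.Quotient.field M
  -- Nullstellensatz: the residue field is finite over `K`, hence equal to `K`.
  have := finite_of_finite_type_of_isJacobsonRing K (A ⧸ M)
  let e := AlgEquiv.ofBijective (Algebra.ofId K (A ⧸ M))
    (IsAlgClosed.algebraMap_bijective_of_isIntegral (k := K) (K := A ⧸ M))
  refine ⟨(e.symm : (A ⧸ M) →ₐ[K] K).comp (Ideal.Quotient.mkₐ K M), fun a ha => ?_⟩
  simp [Ideal.Quotient.eq_zero_iff_mem.2 (hqM ha)]

/-- **Chevalley's theorem** for points: the image of a morphism of affine varieties contains a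
nonempty open subset of its closure, if the latter is irreducible. -/
theorem MvPolynomial.exists_algHom_extension {K A ι : Type*} [Field K] [IsAlgClosed K] [Finite ι]
    [CommRing A] [Algebra K A] [Algebra.FiniteType K A] (φ : MvPolynomial ι K →ₐ[K] A)
    (hφ : (RingHom.ker φ).IsPrime) :
    ∃ f ∉ RingHom.ker φ, ∀ z : ι → K, (∀ p ∈ RingHom.ker φ, eval z p = 0) → eval z f ≠ 0 →
      ∃ χ : A →ₐ[K] K, ∀ i, χ (φ (X i)) = z i := by
  let P : PrimeSpectrum (MvPolynomial ι K) := ⟨RingHom.ker φ, hφ⟩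
  have hfp : (φ : MvPolynomial ι K →+* A).FinitePresentation := by
    refine RingHom.FinitePresentation.of_finiteType.1 ?_
    have h : ((φ : MvPolynomial ι K →+* A).comp (algebraMap K (MvPolynomial ι K))).FiniteType := by
      rw [φ.comp_algebraMap]
      exact RingHom.finiteType_algebraMap.2 inferInstance
    exact RingHom.FiniteType.of_comp_finiteType h
  -- The prime `ker φ` is minimal over the kernel, so it is the contraction of a prime of `A`: the
  -- generic point of the closure lies in the image.
  have hP : P ∈ Set.range (PrimeSpectrum.comap (φ : MvPolynomial ι K →+* A)) := by
    obtain ⟨q, hq, -, hqP⟩ := Ideal.exists_comap_eq_of_mem_minimalPrimes (I := ⊥)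
      (φ : MvPolynomial ι K →+* A) (RingHom.ker φ) (by
        change _ ∈ (RingHom.ker φ).minimalPrimes
        rw [Ideal.minimalPrimes_eq_subsingleton_self]
        rfl)
    exact ⟨⟨q, hq⟩, PrimeSpectrum.ext hqP⟩
  obtain ⟨U, hU, hPU, hUs⟩ :=
    (PrimeSpectrum.isConstructible_range_comap hfp).exists_isOpen_inter_closure P
  -- The image is constructible and contains `P`, so near `P` it contains all of the closure of `P`.
  replace hUs := hUs.resolve_right fun h => h ⟨hPU, subset_closure rfl⟩ hP
  obtain ⟨_, ⟨_, ⟨f, rfl⟩, rfl⟩, hPf, hfU⟩ :=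
    PrimeSpectrum.isBasis_basic_opens.exists_subset_of_mem_open hPU hU
  refine ⟨f, hPf, fun z hz hfz => ?_⟩
  let Q : PrimeSpectrum (MvPolynomial ι K) := ⟨RingHom.ker (eval z), RingHom.ker_isPrime _⟩
  obtain ⟨q, hq⟩ : Q ∈ Set.range (PrimeSpectrum.comap (φ : MvPolynomial ι K →+* A)) := by
    refine hUs ⟨hfU (show Q ∈ PrimeSpectrum.basicOpen f from hfz), ?_⟩
    rw [PrimeSpectrum.closure_singleton]
    exact fun p hp => hz p hp
  obtain ⟨χ, hχ⟩ := exists_algHom_of_isPrime (K := K) q.asIdeal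
  refine ⟨χ, fun i => ?_⟩
  have h : X i - C (z i) ∈ Q.asIdeal := by simp [Q]
  rw [← hq] at h
  have := hχ _ (show φ (X i - C (z i)) ∈ q.asIdeal from h)
  rwa [map_sub, map_sub, sub_eq_zero, ← algebraMap_eq, AlgHom.commutes, AlgHom.commutes,
    Algebra.algebraMap_self_apply] at this

/-! ### Homogeneous Noetherian spaces -/

/-- In a Noetherian space some irreducible component contains a nonempty open set. Homeomorphisms
carry this irreducible open set to a neighbourhood of any point `y` of that component; the
neighbourhood is dense in the component and irreducible, hence contained in it. So the component is
clopen, and connectedness makes it everything. -/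
theorem irreducibleSpace_of_homogeneous {S : Type*} [TopologicalSpace S]
    [TopologicalSpace.NoetherianSpace S] [ConnectedSpace S]
    (h : ∀ x y : S, ∃ e : S ≃ₜ S, e x = y) : IrreducibleSpace S := by
  obtain ⟨x₀⟩ := (inferInstance : Nonempty S)
  obtain ⟨U, hU, ⟨u, hu⟩, hUZ⟩ :=
    TopologicalSpace.NoetherianSpace.exists_isOpen_nonempty_subset_irreducibleComponent _
      (irreducibleComponent_mem_irreducibleComponents x₀)
  have hUi : IsPreirreducible U :=
    isIrreducible_irreducibleComponent.isPreirreducible.open_subset hU hUZ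
  have hopen : IsOpen (irreducibleComponent x₀) := by
    refine isOpen_iff_forall_mem_open.2 fun y hy => ?_
    obtain ⟨e, he⟩ := h u y
    have hV : IsOpen (e '' U) := e.isOpenMap _ hU
    have hVi : IsPreirreducible (e '' U) := hUi.image _ e.continuous.continuousOn
    refine ⟨e '' U, ?_, hV, ⟨u, hu, he⟩⟩
    have hsub : irreducibleComponent x₀ ⊆ closure (e '' U) :=
      (subset_closure_inter_of_isPreirreducible_of_isOpen
        isIrreducible_irreducibleComponent.isPreirreducible hV ⟨y, hy, u, hu, he⟩).trans
        (closure_mono Set.inter_subset_right)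
    have := eq_irreducibleComponent (isPreirreducible_iff_closure.2 hVi) hsub
    exact this ▸ subset_closure
  have huniv : irreducibleComponent x₀ = Set.univ :=
    IsClopen.eq_univ ⟨isClosed_irreducibleComponent, hopen⟩ ⟨x₀, mem_irreducibleComponent⟩
  have hirr := isIrreducible_irreducibleComponent (x := x₀)
  rw [huniv] at hirr
  exact (irreducibleSpace_def S).2 hirr

namespace AffAut

/-! ### Algebras of functions -/

section FunctionAlgebra

variable {K : Type*} [Field K] {T S : Type*}

variable (K) in
/-- The pullback of functions along a map. -/
def pullback (u : S → T) : (T → K) →ₐ[K] (S → K) where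
  toFun f := f ∘ u
  map_one' := rfl
  map_mul' _ _ := rfl
  map_zero' := rfl
  map_add' _ _ := rfl
  commutes' _ := rfl

/-- An algebra of functions on a set which makes the set an affine variety: it is finitely
generated, and its points with values in the base field are the points of the set. -/
def IsAffineAlgebra (A : Subalgebra K (T → K)) : Prop :=
  A.FG ∧ ∀ χ : A →ₐ[K] K, ∃ t, ∀ a : A, χ a = a.1 t

theorem algHom_adjoin_eq_eval {s : Set (T → K)} (χ : Algebra.adjoin K s →ₐ[K] K) (t : T)
    (h : ∀ f (hf : f ∈ s), χ ⟨f, Algebra.subset_adjoin hf⟩ = f t) (a : Algebra.adjoin K s) :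
    χ a = a.1 t := by
  obtain ⟨a, ha⟩ := a
  induction ha using Algebra.adjoin_induction with
  | mem f hf => exact h f hf
  | algebraMap c => exact χ.commutes c
  | add f g hf hg hf' hg' =>
    exact (map_add χ ⟨f, hf⟩ ⟨g, hg⟩).trans (congrArg₂ (· + ·) hf' hg')
  | mul f g hf hg hf' hg' =>
    exact (map_mul χ ⟨f, hf⟩ ⟨g, hg⟩).trans (congrArg₂ (· * ·) hf' hg')

/-- The algebra of functions on a product generated by functions on the factors. -/
def prodAlgebra (A : Subalgebra K (S → K)) (B : Subalgebra K (T → K)) :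
    Subalgebra K (S × T → K) :=
  A.map (pullback K Prod.fst) ⊔ B.map (pullback K Prod.snd)

theorem fst_mem_prodAlgebra {A : Subalgebra K (S → K)} {B : Subalgebra K (T → K)} {f : S → K}
    (hf : f ∈ A) : (fun x : S × T => f x.1) ∈ prodAlgebra A B :=
  (le_sup_left : A.map (pullback K Prod.fst) ≤ prodAlgebra A B) ⟨f, hf, rfl⟩

theorem snd_mem_prodAlgebra {A : Subalgebra K (S → K)} {B : Subalgebra K (T → K)} {f : T → K}
    (hf : f ∈ B) : (fun x : S × T => f x.2) ∈ prodAlgebra A B :=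
  (le_sup_right : B.map (pullback K Prod.snd) ≤ prodAlgebra A B) ⟨f, hf, rfl⟩

/-- A character restricts to a character of each factor, and these are evaluations at some `s` and
`t`. On the generators it agrees with evaluation at `(s, t)`. -/
theorem IsAffineAlgebra.prod {A : Subalgebra K (S → K)} {B : Subalgebra K (T → K)}
    (hA : IsAffineAlgebra A) (hB : IsAffineAlgebra B) : IsAffineAlgebra (prodAlgebra A B) := by
  refine ⟨(hA.1.map _).sup (hB.1.map _), fun χ => ?_⟩
  obtain ⟨s, hs⟩ := hA.2 (χ.comp (((pullback K Prod.fst).comp A.val).codRestrict _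
    fun a => fst_mem_prodAlgebra a.2))
  obtain ⟨t, ht⟩ := hB.2 (χ.comp (((pullback K Prod.snd).comp B.val).codRestrict _
    fun b => snd_mem_prodAlgebra b.2))
  refine ⟨(s, t), fun a => algHom_adjoin_eq_eval χ (s, t) ?_ a⟩
  rintro _ (⟨f, hf, rfl⟩ | ⟨f, hf, rfl⟩)
  · exact hs ⟨f, hf⟩
  · exact ht ⟨f, hf⟩

theorem isAffineAlgebra_of_subsingleton [Unique T] :
    IsAffineAlgebra (⊥ : Subalgebra K (T → K)) := by
  refine ⟨Subalgebra.fg_bot, fun χ => ⟨default, fun a => ?_⟩⟩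
  obtain ⟨_, c, rfl⟩ := a
  exact χ.commutes c

/-! ### Topologies defined by algebras of functions -/

variable {A : Subalgebra K (T → K)} [TopologicalSpace T]

/-- Vanishing ideals embed the closed sets, with order reversed, into the ideals of the Noetherian
ring `A`. -/
theorem noetherianSpace_of_isClosed_iff (hA : A.FG)
    (h : ∀ Z : Set T, IsClosed Z ↔ ∃ F : Set (T → K), F ⊆ A ∧ Z = zeros F) :
    TopologicalSpace.NoetherianSpace T := by
  have : Algebra.FiniteType K A := A.fg_iff_finiteType.1 hA
  have : IsNoetherianRing A := Algebra.FiniteType.isNoetherianRing K A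
  refine ((TopologicalSpace.noetherianSpace_TFAE T).out 0 1).2 ?_
  let I (Z : TopologicalSpace.Closeds T) : Ideal A :=
    { carrier := {a | ∀ t ∈ Z, a.1 t = 0}
      add_mem' := fun ha hb t ht => by simp [ha t ht, hb t ht]
      zero_mem' := fun t _ => rfl
      smul_mem' := fun c a ha t ht => by simp [ha t ht] }
  have hI : StrictAnti I := by
    refine fun Z W hZW => lt_of_le_not_ge (fun a ha t ht => ha t (hZW.le ht)) fun hle => ?_
    refine hZW.not_ge fun t ht => ?_
    obtain ⟨F, hF, hZF⟩ := (h Z).1 Z.isClosed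
    have : t ∈ (Z : Set T) := by
      rw [hZF]
      intro f hf
      refine hle (show (⟨f, hF hf⟩ : A) ∈ I Z from fun t ht => ?_) t ht
      have ht' : t ∈ (Z : Set T) := ht
      rw [hZF] at ht'
      exact ht' f hf
    exact this
  exact hI.wellFoundedLT

theorem continuous_of_isClosed_iff
    (h : ∀ Z : Set T, IsClosed Z ↔ ∃ F : Set (T → K), F ⊆ A ∧ Z = zeros F)
    (e : T → T) (he : ∀ a ∈ A, a ∘ e ∈ A) : Continuous e := by
  refine continuous_iff_isClosed.2 fun Z hZ => ?_
  obtain ⟨F, hF, rfl⟩ := (h Z).1 hZ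
  refine (h _).2 ⟨(· ∘ e) '' F, ?_, ?_⟩
  · rintro _ ⟨f, hf, rfl⟩
    exact he f (hF hf)
  · ext t
    simp [zeros]

theorem eq_zero_or_eq_zero_of_irreducibleSpace [IrreducibleSpace T]
    (h : ∀ Z : Set T, IsClosed Z ↔ ∃ F : Set (T → K), F ⊆ A ∧ Z = zeros F)
    {f g : T → K} (hf : f ∈ A) (hg : g ∈ A) (hfg : ∀ t, f t * g t = 0) :
    (∀ t, f t = 0) ∨ ∀ t, g t = 0 := by
  have hc : ∀ f ∈ A, IsClosed {t | f t = 0} := fun f hf =>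
    (h _).2 ⟨{f}, by simpa using hf, by ext; simp [zeros]⟩
  rcases isPreirreducible_iff_isClosed_union_isClosed.1
    (IrreducibleSpace.isIrreducible_univ T).isPreirreducible _ _ (hc f hf) (hc g hg)
    (fun t _ => mul_eq_zero.1 (hfg t)) with h | h
  · exact Or.inl fun t => h (Set.mem_univ t)
  · exact Or.inr fun t => h (Set.mem_univ t)

end FunctionAlgebra

/-! ### Polynomial functions -/

section PolyFun

variable {K : Type*} [Field K] {V W : Type*} [AddCommGroup V] [Module K V] [AddCommGroup W]
  [Module K W]

theorem linear_mem_polyFun (l : Module.Dual K V) : (l : V → K) ∈ polyFun K V :=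
  Algebra.subset_adjoin ⟨l, rfl⟩

theorem polyFun_comp_linearMap (L : V →ₗ[K] W) {F : W → K} (hF : F ∈ polyFun K W) :
    (fun v => F (L v)) ∈ polyFun K V := by
  have : polyFun K W ≤ (polyFun K V).comap (pullback K L) := by
    refine Algebra.adjoin_le ?_
    rintro _ ⟨l, rfl⟩
    exact linear_mem_polyFun (l.comp L)
  exact this hF

theorem polyFun_fg [FiniteDimensional K V] : (polyFun K V).FG := by
  let b := Module.finBasis K V
  have : polyFun K V = Algebra.adjoin K (Set.range fun i (v : V) => b.coord i v) := by
    refine le_antisymm (Algebra.adjoin_le ?_) (Algebra.adjoin_mono ?_)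
    · rintro _ ⟨l, rfl⟩
      have : (fun v => l v) = ∑ i, l (b i) • fun v => b.coord i v := by
        ext v
        have h := congrArg l (b.sum_repr v)
        rw [map_sum] at h
        simpa [mul_comm] using h.symm
      change (fun v => l v) ∈ _
      rw [this]
      refine sum_mem fun i _ => Subalgebra.smul_mem _ ?_ _
      exact Algebra.subset_adjoin ⟨i, rfl⟩
    · rintro _ ⟨i, rfl⟩
      exact ⟨b.coord i, rfl⟩
  rw [this]
  exact Subalgebra.fg_def.2 ⟨_, Set.finite_range _, rfl⟩

theorem eval_mem_subalgebra {T ι : Type*} (B : Subalgebra K (T → K)) (u : T → ι → K)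
    (hu : ∀ i, (fun t => u t i) ∈ B) (p : MvPolynomial ι K) :
    (fun t => MvPolynomial.eval (u t) p) ∈ B := by
  induction p using MvPolynomial.induction_on with
  | C a => simp only [MvPolynomial.eval_C]; exact B.algebraMap_mem a
  | add p q hp hq => simp only [map_add]; exact B.add_mem hp hq
  | mul_X p i hp => simp only [map_mul, MvPolynomial.eval_X]; exact B.mul_mem hp (hu i)

end PolyFun

variable {K : Type*} [Field K] {n : ℕ} {X : Set (Fin n → K)}

/-! ### Lifting regular functions to polynomials -/

variable (X) in
-- Restriction of polynomials of degree at most `s` is a surjective linear map, hence split.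
-- Linearity of the lift makes its coefficients regular functions of the automorphism.
theorem exists_polynomialLift (s : ℕ) : ∃ σ : regLE X s →ₗ[K] MvPolynomial (Fin n) K,
    ∀ w, restr X (σ w) = w.1 := by
  let L : MvPolynomial.restrictTotalDegree (Fin n) K s →ₗ[K] regLE X s :=
    (restr X).toLinearMap.restrict fun p hp => ⟨p, hp, rfl⟩
  have hL : LinearMap.range L = ⊤ := by
    refine LinearMap.range_eq_top.2 ?_
    rintro ⟨_, p, hp, rfl⟩
    exact ⟨⟨p, hp⟩, rfl⟩
  obtain ⟨σ, hσ⟩ := L.exists_rightInverse_of_surjective hL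
  exact ⟨(Submodule.subtype _).comp σ, fun w => congrArg Subtype.val (LinearMap.congr_fun hσ w)⟩

/-- A linear choice of polynomials restricting to given regular functions of bounded degree. -/
noncomputable def polynomialLift (s : ℕ) : regLE X s →ₗ[K] MvPolynomial (Fin n) K :=
  (exists_polynomialLift X s).choose

theorem eval_polynomialLift {s : ℕ} (w : regLE X s) (x : X) :
    MvPolynomial.eval x.1 (polynomialLift s w) = w.1 x := by
  rw [← restr_apply, polynomialLift, (exists_polynomialLift X s).choose_spec w]

/-- Expanding `w t` in a basis of the finite-dimensional space `regLE X s` leaves only finitely many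
fixed polynomials to evaluate. This gives regularity of the action and of composition in both
arguments jointly. -/
theorem eval_polynomialLift_mem {T : Type*} (B : Subalgebra K (T → K)) {s : ℕ}
    (w : T → regLE X s) (hw : ∀ l : Module.Dual K (regLE X s), (fun t => l (w t)) ∈ B)
    (u : T → Fin n → K) (hu : ∀ i, (fun t => u t i) ∈ B) :
    (fun t => MvPolynomial.eval (u t) (polynomialLift s (w t))) ∈ B := by
  let b := Module.finBasis K (regLE X s)
  have : (fun t => MvPolynomial.eval (u t) (polynomialLift s (w t))) =
      ∑ k, (fun t => b.coord k (w t)) *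
        fun t => MvPolynomial.eval (u t) (polynomialLift s (b k)) := by
    ext t
    conv_lhs => rw [← b.sum_repr (w t)]
    simp [-Module.Basis.sum_repr, MvPolynomial.smul_eval]
  rw [this]
  exact sum_mem fun k _ => B.mul_mem (hw _) (eval_mem_subalgebra B u hu _)

/-! ### The algebra of regular functions on a group of automorphisms of bounded degree -/

/-- The algebra of functions on a group of automorphisms, generated by the coordinates of the
images of points under the automorphisms and their inverses. -/
def groupAlgebra (H : Subgroup (Aut X)) : Subalgebra K (H → K) :=
  Algebra.adjoin K (Set.range (fun (t : X × Fin n) (h : H) => (h.1 • t.1 : X).1 t.2) ∪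
    Set.range (fun (t : X × Fin n) (h : H) => (h.1⁻¹ • t.1 : X).1 t.2))

theorem smul_mem_groupAlgebra (H : Subgroup (Aut X)) (x : X) (i : Fin n) :
    (fun h : H => (h.1 • x : X).1 i) ∈ groupAlgebra H :=
  Algebra.subset_adjoin (Or.inl ⟨(x, i), rfl⟩)

theorem inv_smul_mem_groupAlgebra (H : Subgroup (Aut X)) (x : X) (i : Fin n) :
    (fun h : H => (h.1⁻¹ • x : X).1 i) ∈ groupAlgebra H :=
  Algebra.subset_adjoin (Or.inr ⟨(x, i), rfl⟩)

theorem exists_eval_eq_smul (g : Aut X) (i : Fin n) : ∃ p : MvPolynomial (Fin n) K,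
    ∀ x : X, (g • x : X).1 i = MvPolynomial.eval x.1 p := by
  obtain ⟨p, hp⟩ := g.2.1 i
  exact ⟨p, fun x => (congrFun hp x).symm.trans (restr_apply p x)⟩

/-- The coordinates of `g h x` are polynomials in those of `h x`, and `(g h)⁻¹ x` is `h⁻¹` applied
to the point `g⁻¹ x`. This supplies the homogeneity of `H`. -/
theorem comp_mul_left_mem_groupAlgebra (H : Subgroup (Aut X)) (g : H) {a : H → K}
    (ha : a ∈ groupAlgebra H) : a ∘ (g * ·) ∈ groupAlgebra H := by
  have : groupAlgebra H ≤ (groupAlgebra H).comap (pullback K (g * ·)) := by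
    refine Algebra.adjoin_le ?_
    rintro _ (⟨⟨x, i⟩, rfl⟩ | ⟨⟨x, i⟩, rfl⟩)
    · obtain ⟨p, hp⟩ := exists_eval_eq_smul g.1 i
      have := eval_mem_subalgebra (groupAlgebra H) (fun h : H => (h.1 • x : X).1)
        (smul_mem_groupAlgebra H x) p
      simp only [← hp, ← mul_smul] at this
      exact this
    · have := inv_smul_mem_groupAlgebra H (g.1⁻¹ • x) i
      simp only [← mul_smul, ← mul_inv_rev] at this
      exact this
  exact this ha

section Bounded

variable {H : Subgroup (Aut X)} {s : ℕ} (hs : (H : Set (Aut X)) ⊆ stratum X s)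

/-- The inclusion of a group of automorphisms of bounded degree in the ambient vector space. -/
noncomputable def groupCoords (h : H) : Ambient X s := coords X s ⟨h.1, hs h.2⟩

/-- Point evaluations span the dual of the ambient space (`span_evalForm`), so `groupAlgebra`, which
does not mention `s`, is the coordinate ring coming from the embedding of `Σ_s`. -/
theorem map_polyFun_groupCoords :
    (polyFun K (Ambient X s)).map (pullback K (groupCoords hs)) = groupAlgebra H := by
  refine le_antisymm ?_ (Algebra.adjoin_le ?_)
  · rw [polyFun, AlgHom.map_adjoin]
    refine Algebra.adjoin_le ?_
    rintro _ ⟨_, ⟨l, rfl⟩, rfl⟩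
    have hl : l ∈ Submodule.span K
        (Set.range fun u : Bool × X × Fin n => evalForm s u.1 u.2.1 u.2.2) := by
      rw [span_evalForm]; trivial
    induction hl using Submodule.span_induction with
    | mem l hl =>
      obtain ⟨⟨b, x, i⟩, rfl⟩ := hl
      cases b
      · exact inv_smul_mem_groupAlgebra H x i
      · exact smul_mem_groupAlgebra H x i
    | zero => exact zero_mem (groupAlgebra H)
    | add l m _ _ hl hm => exact add_mem hl hm
    | smul c l _ hl => exact Subalgebra.smul_mem _ hl c
  · rintro _ (⟨⟨x, i⟩, rfl⟩ | ⟨⟨x, i⟩, rfl⟩)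
    · exact ⟨_, linear_mem_polyFun (evalForm s true x i), rfl⟩
    · exact ⟨_, linear_mem_polyFun (evalForm s false x i), rfl⟩

theorem polyFun_groupCoords_mem {F : Ambient X s → K} (hF : F ∈ polyFun K (Ambient X s)) :
    (fun h => F (groupCoords hs h)) ∈ groupAlgebra H := by
  rw [← map_polyFun_groupCoords hs]
  exact ⟨F, hF, rfl⟩

theorem exists_eq_polyFun_groupCoords {a : H → K} (ha : a ∈ groupAlgebra H) :
    ∃ F ∈ polyFun K (Ambient X s), a = fun h => F (groupCoords hs h) := by
  rw [← map_polyFun_groupCoords hs] at ha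
  obtain ⟨F, hF, rfl⟩ := ha
  exact ⟨F, hF, rfl⟩

/-- The `i`-th component of the first map, as a linear map. -/
noncomputable def fstComponent (s : ℕ) (i : Fin n) : Ambient X s →ₗ[K] regLE X s :=
  (LinearMap.proj i).comp (LinearMap.fst K _ _)

/-- The `i`-th component of the second map, as a linear map. -/
noncomputable def sndComponent (s : ℕ) (i : Fin n) : Ambient X s →ₗ[K] regLE X s :=
  (LinearMap.proj i).comp (LinearMap.snd K _ _)

/-- Evaluation of regular functions of bounded degree at a point. -/
noncomputable def evalAt (s : ℕ) (x : X) : Module.Dual K (regLE X s) :=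
  (LinearMap.proj x).comp (Submodule.subtype _)

/-- On linear forms a character is an element of the double dual, hence evaluation at a vector. -/
theorem exists_ambient_eq_algHom (χ : groupAlgebra H →ₐ[K] K) :
    ∃ v : Ambient X s, ∀ F (hF : F ∈ polyFun K (Ambient X s)),
      χ ⟨_, polyFun_groupCoords_mem hs hF⟩ = F v := by
  let ψ : polyFun K (Ambient X s) →ₐ[K] K := χ.comp
    (((pullback K (groupCoords hs)).comp (polyFun K (Ambient X s)).val).codRestrict _
      fun F => polyFun_groupCoords_mem hs F.2)
  let Λ : Module.Dual K (Ambient X s) →ₗ[K] K :=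
    { toFun := fun l => ψ ⟨l, linear_mem_polyFun l⟩
      map_add' := fun l m => map_add ψ ⟨l, linear_mem_polyFun l⟩ ⟨m, linear_mem_polyFun m⟩
      map_smul' := fun c l => map_smul ψ c ⟨l, linear_mem_polyFun l⟩ }
  refine ⟨(Module.evalEquiv K (Ambient X s)).symm Λ, fun F hF => ?_⟩
  refine algHom_adjoin_eq_eval ψ _ ?_ ⟨F, hF⟩
  rintro _ ⟨l, rfl⟩
  exact (Module.apply_evalEquiv_symm_apply K _ l Λ).symm

end Bounded

section Bounded

variable {H : Subgroup (Aut X)} {s : ℕ}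

/-- A character is evaluation at some ambient vector `v`, and every polynomial relation valid on `H`
holds at `v`. The relations say that the two halves of `v` map `X` to itself, are mutually inverse,
and satisfy the equations of `H`; so `v` is a point of `H`. -/
theorem isAffineAlgebra_groupAlgebra (hX : IsClosed[zariskiTopology K (Fin n → K)] X)
    (hs : (H : Set (Aut X)) ⊆ stratum X s)
    (hH : IsClosed[stratumTopology X s] (Subtype.val ⁻¹' (H : Set (Aut X)))) :
    IsAffineAlgebra (groupAlgebra H) := by
  refine ⟨by rw [← map_polyFun_groupCoords hs]; exact polyFun_fg.map _, fun χ => ?_⟩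
  obtain ⟨v, hv⟩ := exists_ambient_eq_algHom hs χ
  have key : ∀ F ∈ polyFun K (Ambient X s), (∀ h : H, F (groupCoords hs h) = 0) → F v = 0 := by
    intro F hF h
    rw [← hv F hF]
    have : (⟨_, polyFun_groupCoords_mem hs hF⟩ : groupAlgebra H) = 0 := Subtype.ext (funext h)
    rw [this, map_zero]
  have hmaps : ∀ L : Fin n → Ambient X s →ₗ[K] regLE X s, ∀ x : X,
      (∀ h : H, (fun i => (L i (groupCoords hs h)).1 x) ∈ X) → (fun i => (L i v).1 x) ∈ X := by
    intro L x hL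
    obtain ⟨S, hS, hXS⟩ := isClosed_zariski_iff.1 hX
    refine (Set.ext_iff.1 hXS _).2 fun p hp => ?_
    refine key _ (polyFun_comp_linearMap
      (LinearMap.pi fun i => (evalAt s x).comp (L i)) (hS hp)) fun h => ?_
    exact (Set.ext_iff.1 hXS _).1 (hL h) p hp
  -- Composition of the two halves is polynomial in `v` once regular functions are lifted linearly
  -- to polynomials; being the identity is then a relation inherited from `H`.
  have hcomp : ∀ L M : Fin n → Ambient X s →ₗ[K] regLE X s, ∀ (x : X) (i : Fin n),
      (∀ h : H, MvPolynomial.eval (fun j => (M j (groupCoords hs h)).1 x)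
        (polynomialLift s (L i (groupCoords hs h))) = x.1 i) →
      MvPolynomial.eval (fun j => (M j v).1 x) (polynomialLift s (L i v)) = x.1 i := by
    intro L M x i h
    refine sub_eq_zero.1 (key (fun v => MvPolynomial.eval (fun j => (M j v).1 x)
        (polynomialLift s (L i v)) - x.1 i) (sub_mem ?_ (Subalgebra.algebraMap_mem _ (x.1 i)))
        fun h' => sub_eq_zero.2 (h h'))
    exact eval_polynomialLift_mem _ _ (fun l => linear_mem_polyFun (l.comp (L i))) _
      fun j => linear_mem_polyFun ((evalAt s x).comp (M j))
  let f : X → X := fun x => ⟨fun i => (fstComponent s i v).1 x,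
    hmaps (fstComponent s) x fun h => (h.1 • x).2⟩
  let g : X → X := fun x => ⟨fun i => (sndComponent s i v).1 x,
    hmaps (sndComponent s) x fun h => (h.1⁻¹ • x).2⟩
  have hfg : ∀ x, f (g x) = x := fun x => Subtype.ext <| funext fun i => by
    refine (eval_polynomialLift (fstComponent s i v) (g x)).symm.trans
      (hcomp (fstComponent s) (sndComponent s) x i fun h => ?_)
    refine (eval_polynomialLift _ (h.1⁻¹ • x)).trans ?_
    change (h.1 • h.1⁻¹ • x).1 i = _
    rw [smul_inv_smul]
  have hgf : ∀ x, g (f x) = x := fun x => Subtype.ext <| funext fun i => by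
    refine (eval_polynomialLift (sndComponent s i v) (f x)).symm.trans
      (hcomp (sndComponent s) (fstComponent s) x i fun h => ?_)
    refine (eval_polynomialLift _ (h.1 • x)).trans ?_
    change (h.1⁻¹ • h.1 • x).1 i = _
    rw [inv_smul_smul]
  have hreg : ∀ w : regLE X s, w.1 ∈ (restr X).range := by
    rintro ⟨_, p, -, rfl⟩
    exact ⟨p, rfl⟩
  let α : Aut X := ⟨⟨f, g, hgf, hfg⟩, fun i => hreg (v.1 i), fun i => hreg (v.2 i)⟩
  have hα : α ∈ stratum X s := fun i => ⟨(v.1 i).2, (v.2 i).2⟩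
  have hαv : coords X s ⟨α, hα⟩ = v := rfl
  obtain ⟨S, hS, hSH⟩ := exists_zeros_of_isClosed hH
  have hαH : α ∈ H := (hSH ⟨α, hα⟩).2 fun F hF =>
    key F (hS hF) fun h => (hSH ⟨h.1, hs h.2⟩).1 h.2 F hF
  refine ⟨⟨α, hαH⟩, fun a => ?_⟩
  obtain ⟨a, ha⟩ := a
  obtain ⟨F, hF, rfl⟩ := exists_eq_polyFun_groupCoords hs ha
  exact hv F hF

/-- The Zariski topology on a group of automorphisms of bounded degree. -/
@[reducible]
noncomputable def groupTopology (hs : (H : Set (Aut X)) ⊆ stratum X s) : TopologicalSpace H :=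
  (stratumTopology X s).induced fun h => ⟨h.1, hs h.2⟩

theorem isClosed_groupTopology_iff (hs : (H : Set (Aut X)) ⊆ stratum X s) (Z : Set H) :
    IsClosed[groupTopology hs] Z ↔ ∃ F : Set (H → K), F ⊆ groupAlgebra H ∧ Z = zeros F := by
  constructor
  · intro hZ
    obtain ⟨C, hC, rfl⟩ := (@isClosed_induced_iff _ _ (stratumTopology X s) _ _).1 hZ
    obtain ⟨S, hS, hSC⟩ := exists_zeros_of_isClosed hC
    refine ⟨(fun F h => F (groupCoords hs h)) '' S, ?_, ?_⟩
    · rintro _ ⟨F, hF, rfl⟩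
      exact polyFun_groupCoords_mem hs (hS hF)
    · ext h
      simp only [zeros, Set.mem_preimage, Set.mem_ofPred_eq, Set.forall_mem_image, hSC]
      rfl
  · rintro ⟨F, hF, rfl⟩
    choose! P hP hFP using fun a (ha : a ∈ F) => exists_eq_polyFun_groupCoords hs (hF ha)
    refine (@isClosed_induced_iff _ _ (stratumTopology X s) _ _).2
      ⟨zeros ((fun a α => P a (coords X s α)) '' F), isClosed_zeros_stratum ?_, ?_⟩
    · rintro _ ⟨a, ha, rfl⟩
      exact ⟨P a, hP a ha, rfl⟩
    · ext h
      simp only [zeros, Set.mem_preimage, Set.mem_ofPred_eq, Set.forall_mem_image]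
      exact forall₂_congr fun a ha => by rw [congrFun (hFP a ha) h]; rfl

theorem connectedSpace_groupTopology (hs : (H : Set (Aut X)) ⊆ stratum X s)
    (hH : @IsConnected _ (stratumTopology X s) (Subtype.val ⁻¹' (H : Set (Aut X)))) :
    @ConnectedSpace H (groupTopology hs) := by
  let _ := stratumTopology X s
  let _ := groupTopology hs
  let j : H → stratum X s := fun h => ⟨h.1, hs h.2⟩
  have hj : Topology.IsInducing j := ⟨rfl⟩
  have hrange : j '' Set.univ = Subtype.val ⁻¹' (H : Set (Aut X)) := by
    ext α
    simp only [Set.image_univ, Set.mem_range, Set.mem_preimage, SetLike.mem_coe]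
    exact ⟨fun ⟨h, hα⟩ => hα ▸ h.2, fun hα => ⟨⟨α.1, hα⟩, rfl⟩⟩
  refine connectedSpace_iff_univ.2 ⟨⟨1, trivial⟩, hj.isPreconnected_image.1 ?_⟩
  rw [hrange]
  exact hH.isPreconnected

/-- Left translations act transitively by homeomorphisms, so the connected Noetherian space `H` is
irreducible. -/
theorem groupAlgebra_eq_zero_or_eq_zero (hs : (H : Set (Aut X)) ⊆ stratum X s)
    (hH : @IsConnected _ (stratumTopology X s) (Subtype.val ⁻¹' (H : Set (Aut X))))
    {f g : H → K} (hf : f ∈ groupAlgebra H) (hg : g ∈ groupAlgebra H)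
    (hfg : ∀ h, f h * g h = 0) : (∀ h, f h = 0) ∨ ∀ h, g h = 0 := by
  let _ := groupTopology hs
  have hclosed := isClosed_groupTopology_iff hs
  have := connectedSpace_groupTopology hs hH
  have : TopologicalSpace.NoetherianSpace H := noetherianSpace_of_isClosed_iff
    (by rw [← map_polyFun_groupCoords hs]; exact polyFun_fg.map _) hclosed
  have hcont : ∀ k : H, Continuous (k * ·) := fun k =>
    continuous_of_isClosed_iff hclosed _ fun a => comp_mul_left_mem_groupAlgebra H k
  have : IrreducibleSpace H := irreducibleSpace_of_homogeneous fun x y =>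
    ⟨⟨Equiv.mulLeft (y * x⁻¹), hcont _, hcont _⟩, by
      change y * x⁻¹ * x = y
      group⟩
  exact eq_zero_or_eq_zero_of_irreducibleSpace hclosed hf hg hfg

end Bounded

end AffAut

namespace AffAut

universe u

variable {K : Type u} [Field K] {n m : ℕ} {X : Set (Fin n → K)}

/-! ### Tuples of points and their vanishing ideals -/

/-- The coordinates of a tuple of points. -/
def tupleCoords (y : Fin m → X) (t : Fin m × Fin n) : K := (y t.1).1 t.2

/-- The ideal of polynomials vanishing on a set of tuples of points. -/
noncomputable def tupleIdeal (Y : Set (Fin m → X)) : Ideal (MvPolynomial (Fin m × Fin n) K) :=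
  ⨅ y ∈ Y, RingHom.ker (MvPolynomial.eval (tupleCoords y))

theorem mem_tupleIdeal {Y : Set (Fin m → X)} {p : MvPolynomial (Fin m × Fin n) K} :
    p ∈ tupleIdeal Y ↔ ∀ y ∈ Y, MvPolynomial.eval (tupleCoords y) p = 0 := by
  simp [tupleIdeal, Submodule.mem_iInf]

theorem tupleIdeal_anti {Y Z : Set (Fin m → X)} (h : Y ⊆ Z) : tupleIdeal Z ≤ tupleIdeal Y :=
  fun _ hp => mem_tupleIdeal.2 fun y hy => mem_tupleIdeal.1 hp y (h hy)

/-- The Zariski closure of a set of tuples of points. -/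
def tupleClosure (Y : Set (Fin m → X)) : Set (Fin m → X) :=
  {z | ∀ p ∈ tupleIdeal Y, MvPolynomial.eval (tupleCoords z) p = 0}

theorem subset_tupleClosure (Y : Set (Fin m → X)) : Y ⊆ tupleClosure Y :=
  fun y hy _ hp => mem_tupleIdeal.1 hp y hy

theorem exists_eval_tupleCoords_smul (g : Aut X) (p : MvPolynomial (Fin m × Fin n) K) :
    ∃ q : MvPolynomial (Fin m × Fin n) K, ∀ y : Fin m → X,
      MvPolynomial.eval (tupleCoords (g • y)) p = MvPolynomial.eval (tupleCoords y) q := by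
  choose r hr using exists_eval_eq_smul g
  refine ⟨MvPolynomial.bind₁ (fun t => MvPolynomial.rename (fun i => (t.1, i)) (r t.2)) p,
    fun y => ?_⟩
  rw [← MvPolynomial.coe_aeval_eq_eval, ← MvPolynomial.coe_aeval_eq_eval, RingHom.coe_coe,
    RingHom.coe_coe, MvPolynomial.aeval_bind₁]
  congr 2
  ext t
  rw [MvPolynomial.aeval_rename]
  exact (hr t.2 (y t.1)).trans (by rw [← MvPolynomial.coe_aeval_eq_eval]; rfl)

theorem eval_tupleCoords_smul_mem (H : Subgroup (Aut X)) (y : Fin m → X)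
    (p : MvPolynomial (Fin m × Fin n) K) :
    (fun h : H => MvPolynomial.eval (tupleCoords (h.1 • y)) p) ∈ groupAlgebra H :=
  eval_mem_subalgebra (groupAlgebra H) (fun h : H => tupleCoords (h.1 • y))
    (fun t => smul_mem_groupAlgebra H (y t.1) t.2) p

/-- The set of images of the elements of `Y` under the elements of `H`. -/
def translates (H : Subgroup (Aut X)) (Y : Set (Fin m → X)) : Set (Fin m → X) :=
  Set.image2 (· • ·) (H : Set (Aut X)) Y

theorem subset_translates (H : Subgroup (Aut X)) (Y : Set (Fin m → X)) : Y ⊆ translates H Y :=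
  fun y hy => ⟨1, H.one_mem, y, hy, one_smul _ y⟩

/-- If `p` is nonzero at `g • y` and `q` at `k • z`, then primality for `Y` gives a single `w` in
`Y` with `p (g • w)` and `q (k • w)` both nonzero. With `w` fixed, `h ↦ p (h • w)` and `h ↦ q (h •
w)` are nonzero regular functions on the irreducible `H`, so their product is not identically zero.
-/
theorem isPrime_tupleIdeal_translates {H : Subgroup (Aut X)} (hH : IsConnectedAlgebraic H)
    {Y : Set (Fin m → X)} (hY : (tupleIdeal Y).IsPrime) :
    (tupleIdeal (translates H Y)).IsPrime := by
  obtain ⟨s, hs, -, hconn⟩ := hH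
  refine ⟨fun h => hY.ne_top (top_le_iff.1 (h ▸ tupleIdeal_anti (subset_translates H Y))),
    fun {p q} hpq => ?_⟩
  by_contra! hcon
  simp only [mem_tupleIdeal, translates, Set.forall_mem_image2, not_forall] at hcon
  obtain ⟨⟨g, hg, y, hy, hp⟩, ⟨k, hk, z, hz, hq⟩⟩ := hcon
  obtain ⟨p', hp'⟩ := exists_eval_tupleCoords_smul g p
  obtain ⟨q', hq'⟩ := exists_eval_tupleCoords_smul k q
  have hp'Y : p' ∉ tupleIdeal Y := fun h => hp (by rw [hp', mem_tupleIdeal.1 h y hy])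
  have hq'Y : q' ∉ tupleIdeal Y := fun h => hq (by rw [hq', mem_tupleIdeal.1 h z hz])
  have hprod : p' * q' ∉ tupleIdeal Y := fun h => (hY.mem_or_mem h).elim hp'Y hq'Y
  simp only [mem_tupleIdeal, not_forall] at hprod
  obtain ⟨w, hw, hpqw⟩ := hprod
  rw [map_mul, ← hp', ← hq'] at hpqw
  rcases groupAlgebra_eq_zero_or_eq_zero hs hconn (eval_tupleCoords_smul_mem H w p)
    (eval_tupleCoords_smul_mem H w q) (fun h => by
      rw [← map_mul]
      exact mem_tupleIdeal.1 hpq _ ⟨h.1, h.2, w, hw, rfl⟩) with h | h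
  · exact hpqw (by rw [h ⟨g, hg⟩, zero_mul])
  · exact hpqw (by rw [h ⟨k, hk⟩, mul_zero])

/-! ### Images of affine varieties -/

/-- A set of tuples of points is parametrized if it is the image of a morphism from an affine
variety. -/
def IsParametrized (Y : Set (Fin m → X)) : Prop :=
  ∃ (T : Type u) (A : Subalgebra K (T → K)) (φ : T → Fin m → X), IsAffineAlgebra A ∧
    (∀ j i, (fun t => (φ t j).1 i) ∈ A) ∧ Set.range φ = Y

theorem isParametrized_singleton (y : Fin m → X) : IsParametrized {y} :=
  ⟨PUnit, ⊥, fun _ => y, isAffineAlgebra_of_subsingleton,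
    fun j i => Subalgebra.algebraMap_mem ⊥ ((y j).1 i), Set.range_const⟩

theorem IsParametrized.translates (hX : IsClosed[zariskiTopology K (Fin n → K)] X)
    {H : Subgroup (Aut X)} (hH : IsConnectedAlgebraic H) {Y : Set (Fin m → X)}
    (hY : IsParametrized Y) : IsParametrized (translates H Y) := by
  obtain ⟨s, hs, hclosed, -⟩ := hH
  obtain ⟨T, A, φ, hA, hφ, rfl⟩ := hY
  refine ⟨H × T, prodAlgebra (groupAlgebra H) A, fun t => t.1.1 • φ t.2,
    (isAffineAlgebra_groupAlgebra hX hs hclosed).prod hA, fun j i => ?_, ?_⟩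
  · have := eval_polynomialLift_mem (prodAlgebra (groupAlgebra H) A)
      (fun t => fstComponent s i (groupCoords hs t.1))
      (fun l => fst_mem_prodAlgebra (polyFun_groupCoords_mem hs
        (linear_mem_polyFun (l.comp (fstComponent s i)))))
      (fun t => (φ t.2 j).1) (fun k => snd_mem_prodAlgebra (hφ j k))
    simp only [eval_polynomialLift] at this
    exact this
  · ext z
    constructor
    · rintro ⟨⟨h, t⟩, rfl⟩
      exact ⟨h.1, h.2, φ t, ⟨t, rfl⟩, rfl⟩
    · rintro ⟨h, hh, _, ⟨t, rfl⟩, rfl⟩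
      exact ⟨(⟨h, hh⟩, t), rfl⟩

/-- Chevalley's theorem for the comorphism `ψ` of the parametrization, whose kernel is the vanishing
ideal of the image. The character it produces over `z` is evaluation at a parameter mapping to `z`,
because the parameter space is affine. -/
theorem IsParametrized.exists_open_subset [IsAlgClosed K] {Y : Set (Fin m → X)}
    (hY : IsParametrized Y) (hprime : (tupleIdeal Y).IsPrime) :
    ∃ f ∉ tupleIdeal Y, ∀ z ∈ tupleClosure Y,
      MvPolynomial.eval (tupleCoords z) f ≠ 0 → z ∈ Y := by
  obtain ⟨T, A, φ, hA, hφ, rfl⟩ := hY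
  have : Algebra.FiniteType K A := A.fg_iff_finiteType.1 hA.1
  let ψ : MvPolynomial (Fin m × Fin n) K →ₐ[K] A :=
    MvPolynomial.aeval fun t => ⟨_, hφ t.1 t.2⟩
  have hψ : ∀ p t, (ψ p).1 t = MvPolynomial.eval (tupleCoords (φ t)) p := by
    intro p t
    have : ((Pi.evalAlgHom K (fun _ : T => K) t).comp A.val).comp ψ =
        MvPolynomial.aeval (tupleCoords (φ t)) := by
      ext i
      simp [ψ, tupleCoords]
    rw [← MvPolynomial.coe_aeval_eq_eval]
    exact DFunLike.congr_fun this p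
  have hker : RingHom.ker ψ = tupleIdeal (Set.range φ) := by
    ext p
    rw [mem_tupleIdeal, Set.forall_mem_range, RingHom.mem_ker]
    simp only [← hψ]
    exact ⟨fun h t => by rw [h]; rfl, fun h => Subtype.ext (funext h)⟩
  obtain ⟨f, hf, hext⟩ := MvPolynomial.exists_algHom_extension ψ (hker ▸ hprime)
  refine ⟨f, hker ▸ hf, fun z hz hfz => ?_⟩
  obtain ⟨χ, hχ⟩ := hext (tupleCoords z) (fun p hp => hz p (hker ▸ hp)) hfz
  obtain ⟨t, ht⟩ := hA.2 χ
  refine ⟨t, funext fun j => Subtype.ext (funext fun i => ?_)⟩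
  rw [show (z j).1 i = tupleCoords z (j, i) from rfl, ← hχ, ht, hψ, MvPolynomial.eval_X]
  rfl

/-! ### Orbits of algebraically generated groups -/

/-- The sets of the form `H₁ ⋯ H_N . P` with `H₁, …, H_N` in the family `𝓕`. -/
inductive IsReachable (𝓕 : Set (Subgroup (Aut X))) (P : Fin m → X) : Set (Fin m → X) → Prop
  | base : IsReachable 𝓕 P {P}
  | step {H : Subgroup (Aut X)} {Y : Set (Fin m → X)} (hH : H ∈ 𝓕) (hY : IsReachable 𝓕 P Y) :
      IsReachable 𝓕 P (translates H Y)

section Reachable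

variable {𝓕 : Set (Subgroup (Aut X))} {P : Fin m → X} {Y : Set (Fin m → X)}

theorem IsReachable.mem (hY : IsReachable 𝓕 P Y) : P ∈ Y := by
  induction hY with
  | base => rfl
  | step _ _ ih => exact subset_translates _ _ ih

theorem IsReachable.subset_orbit (hY : IsReachable 𝓕 P Y) :
    Y ⊆ MulAction.orbit (sSup 𝓕 : Subgroup (Aut X)) P := by
  induction hY with
  | base => exact Set.singleton_subset_iff.2 (MulAction.mem_orbit_self P)
  | @step H Y hH _ ih =>
    rintro _ ⟨h, hh, y, hy, rfl⟩
    obtain ⟨g, rfl⟩ := ih hy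
    exact ⟨⟨h, le_sSup hH hh⟩ * g, mul_smul _ _ _⟩

theorem IsReachable.isPrime (h𝓕 : ∀ H ∈ 𝓕, IsConnectedAlgebraic H) (hY : IsReachable 𝓕 P Y) :
    (tupleIdeal Y).IsPrime := by
  induction hY with
  | base =>
    rw [tupleIdeal, iInf_singleton]
    exact RingHom.ker_isPrime _
  | step hH _ ih => exact isPrime_tupleIdeal_translates (h𝓕 _ hH) ih

theorem IsReachable.isParametrized (hX : IsClosed[zariskiTopology K (Fin n → K)] X)
    (h𝓕 : ∀ H ∈ 𝓕, IsConnectedAlgebraic H) (hY : IsReachable 𝓕 P Y) : IsParametrized Y := by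
  induction hY with
  | base => exact isParametrized_singleton P
  | step hH _ ih => exact ih.translates hX (h𝓕 _ hH)

/-- Choose a reachable set whose vanishing ideal has minimal height. One more factor can only shrink
the ideal, and a strict inclusion of primes in a polynomial ring would lower the height. -/
theorem exists_isReachable_tupleIdeal_translates_eq (h𝓕 : ∀ H ∈ 𝓕, IsConnectedAlgebraic H)
    (P : Fin m → X) :
    ∃ Y, IsReachable 𝓕 P Y ∧ ∀ H ∈ 𝓕, tupleIdeal (translates H Y) = tupleIdeal Y := by
  obtain ⟨_, ⟨Y, hY, rfl⟩, hmin⟩ := wellFounded_lt.has_min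
    ((fun Y => (tupleIdeal Y).height) '' {Y | IsReachable 𝓕 P Y}) ⟨_, _, IsReachable.base, rfl⟩
  replace hY : IsReachable 𝓕 P Y := hY
  refine ⟨Y, hY, fun H hH => ?_⟩
  by_contra hne
  have := hY.isPrime h𝓕
  have := (hY.step hH).isPrime h𝓕
  exact hmin _ ⟨_, hY.step hH, rfl⟩ (Ideal.height_strict_mono_of_isPrime
    (lt_of_le_of_ne (tupleIdeal_anti (subset_translates H Y)) hne))

open scoped Pointwise in
theorem orbit_subset_tupleClosure (hY : IsReachable 𝓕 P Y)
    (h : ∀ H ∈ 𝓕, tupleIdeal (translates H Y) = tupleIdeal Y) :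
    MulAction.orbit (sSup 𝓕 : Subgroup (Aut X)) P ⊆ tupleClosure Y := by
  have hsmul : ∀ H ∈ 𝓕, ∀ g ∈ H, ∀ z ∈ tupleClosure Y, g • z ∈ tupleClosure Y := by
    intro H hH g hg z hz p hp
    obtain ⟨q, hq⟩ := exists_eval_tupleCoords_smul g p
    rw [hq]
    refine hz q (mem_tupleIdeal.2 fun y hy => ?_)
    rw [← h H hH] at hp
    rw [← hq]
    exact mem_tupleIdeal.1 hp _ ⟨g, hg, y, hy, rfl⟩
  -- Stability under each generating subgroup, inverses included, puts it in the stabilizer; the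
  -- group they generate follows.
  have hle : sSup 𝓕 ≤ MulAction.stabilizer (Aut X) (tupleClosure Y) := by
    refine sSup_le fun H hH g hg => MulAction.mem_stabilizer_set.2 fun z => ⟨fun hz => ?_, ?_⟩
    · simpa using hsmul H hH g⁻¹ (H.inv_mem hg) _ hz
    · exact hsmul H hH g hg z
  rintro _ ⟨g, rfl⟩
  exact (MulAction.mem_stabilizer_set.1 (hle g.2) P).2 (subset_tupleClosure Y hY.mem)

end Reachable

/-- Orbits of algebraically generated groups contain nonempty open subsets of their closures. -/
theorem exists_open_subset_orbit [IsAlgClosed K]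
    (hX : IsClosed[zariskiTopology K (Fin n → K)] X) {G : Subgroup (Aut X)}
    (hG : IsAlgebraicallyGenerated G) (P : Fin m → X) :
    ∃ f ∉ tupleIdeal (MulAction.orbit G P), ∀ z ∈ tupleClosure (MulAction.orbit G P),
      MvPolynomial.eval (tupleCoords z) f ≠ 0 → z ∈ MulAction.orbit G P := by
  obtain ⟨𝓕, h𝓕, rfl⟩ := hG
  obtain ⟨Y, hY, hstable⟩ := exists_isReachable_tupleIdeal_translates_eq h𝓕 P
  have heq : tupleIdeal (MulAction.orbit (sSup 𝓕 : Subgroup (Aut X)) P) = tupleIdeal Y :=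
    le_antisymm (tupleIdeal_anti hY.subset_orbit) fun p hp => mem_tupleIdeal.2 fun z hz =>
      orbit_subset_tupleClosure hY hstable hz p hp
  obtain ⟨f, hf, hfY⟩ := (hY.isParametrized hX h𝓕).exists_open_subset (hY.isPrime h𝓕)
  refine ⟨f, heq ▸ hf, fun z hz hfz => hY.subset_orbit (hfY z ?_ hfz)⟩
  rwa [tupleClosure, ← heq]

/-! ### Orbits of closures of algebraically generated groups -/

theorem limClosureSet_subset_indClosureSet (F : Set (Aut X)) :
    limClosureSet F ⊆ indClosureSet F := by
  refine Set.iUnion_subset fun s => ?_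
  rintro _ ⟨α, hα, rfl⟩
  let _ := stratumTopology X s
  exact closure_minimal (Set.preimage_mono (@subset_closure _ (indTopology X) F))
    (isClosed_ind_iff.1 (@isClosed_closure _ (indTopology X) F) s) hα

/-- On each `Σ_s`, the function `α ↦ p (α • P)` is regular for every polynomial `p`. -/
theorem isClosed_smul_mem_tupleClosure (P : Fin m → X) (Y : Set (Fin m → X)) :
    IsClosed[indTopology X] {α : Aut X | α • P ∈ tupleClosure Y} := by
  refine isClosed_ind_iff.2 fun s => ?_
  have hmem : ∀ p : MvPolynomial (Fin m × Fin n) K,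
      (fun α : stratum X s => MvPolynomial.eval (tupleCoords (α.1 • P)) p) ∈ stratumFun s := by
    intro p
    have hcoord : ∀ t : Fin m × Fin n, (fun α : stratum X s => tupleCoords (α.1 • P) t) ∈
        (polyFun K (Ambient X s)).map (pullback K (coords X s)) := by
      intro t
      obtain ⟨F, hF, hFt⟩ := eval_mem s (P t.1) t.2
      exact ⟨F, hF, hFt.symm⟩
    obtain ⟨F, hF, hFp⟩ := eval_mem_subalgebra _ _ hcoord p
    exact ⟨F, hF, hFp.symm⟩
  have heq : (Subtype.val ⁻¹' {α : Aut X | α • P ∈ tupleClosure Y} : Set (stratum X s)) =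
      zeros ((fun p (α : stratum X s) => MvPolynomial.eval (tupleCoords (α.1 • P)) p) ''
        tupleIdeal Y) := by
    ext α
    simp only [zeros, Set.mem_preimage, Set.mem_ofPred_eq, Set.forall_mem_image]
    rfl
  rw [heq]
  refine isClosed_zeros_stratum ?_
  rintro _ ⟨p, -, rfl⟩
  exact hmem p

theorem smul_mem_tupleClosure_orbit {G : Subgroup (Aut X)} {α : Aut X} (hα : α ∈ indClosure G)
    (P : Fin m → X) : α • P ∈ tupleClosure (MulAction.orbit G P) := by
  let _ := indTopology X
  have hsub : (G : Set (Aut X)) ⊆ {α | α • P ∈ tupleClosure (MulAction.orbit G P)} :=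
    fun g hg => subset_tupleClosure _ ⟨⟨g, hg⟩, rfl⟩
  exact closure_minimal hsub (isClosed_smul_mem_tupleClosure P (MulAction.orbit G P)) hα

theorem le_indClosure (G : Subgroup (Aut X)) : G ≤ indClosure G :=
  fun _ hg => @subset_closure _ (indTopology X) _ _ hg

theorem smul_mem_orbit_of_mem_indClosure [IsAlgClosed K]
    (hX : IsClosed[zariskiTopology K (Fin n → K)] X) {G : Subgroup (Aut X)}
    (hG : IsAlgebraicallyGenerated G) {α : Aut X} (hα : α ∈ indClosure G) (P : Fin m → X) :
    α • P ∈ MulAction.orbit G P := by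
  -- For `g` in `G` the product `g * β` is again in the closure, so all of `G.(βQ)` lies in the
  -- closure of `G.Q`.
  have hle : ∀ β ∈ indClosure G, ∀ Q : Fin m → X,
      tupleIdeal (MulAction.orbit G Q) ≤ tupleIdeal (MulAction.orbit G (β • Q)) := by
    refine fun β hβ Q p hp => mem_tupleIdeal.2 ?_
    rintro _ ⟨g, rfl⟩
    have := smul_mem_tupleClosure_orbit (mul_mem (le_indClosure G g.2) hβ) Q p hp
    rwa [mul_smul] at this
  have heq : tupleIdeal (MulAction.orbit G (α • P)) ≤ tupleIdeal (MulAction.orbit G P) := by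
    simpa using hle α⁻¹ (inv_mem hα) (α • P)
  obtain ⟨f, hf, hopen⟩ := exists_open_subset_orbit hX hG P
  -- By `heq`, a polynomial vanishing on `G.(αP)` vanishes on `G.P`, and `f` does not; this `z` will
  -- lie in both orbits.
  obtain ⟨z, hz, hfz⟩ : ∃ z ∈ MulAction.orbit G (α • P),
      MvPolynomial.eval (tupleCoords z) f ≠ 0 := by
    by_contra! h
    exact hf (heq (mem_tupleIdeal.2 h))
  have hzP := hopen z (fun p hp => mem_tupleIdeal.1 (hle α hα P hp) z hz) hfz
  rw [← MulAction.orbit_eq_iff] at hz hzP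
  rw [← MulAction.orbit_eq_iff, ← hz, hzP]

end AffAut

theorem mainTheorem5 {K : Type*} [Field K] [IsAlgClosed K] [CharZero K] {n : ℕ}
    (X : Set (Fin n → K)) (hX : IsClosed[AffAut.zariskiTopology K (Fin n → K)] X)
    (G : Subgroup (AffAut.Aut X)) (hG : AffAut.IsAlgebraicallyGenerated G)
    (Gbar : Subgroup (AffAut.Aut X))
    (hGbar : Gbar = AffAut.indClosure G ∨ Gbar = AffAut.limClosure G) :
    ((∀ x : X, MulAction.orbit G x = MulAction.orbit Gbar x) ∧
      ∀ O : Set X, AffAut.IsOpenOrbit Gbar O ↔ AffAut.IsOpenOrbit G O) ∧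
    (∀ O : Set X, AffAut.IsOpenOrbit Gbar O → ∀ m : ℕ, 1 ≤ m →
      AffAut.IsMTransitiveOn Gbar m O → AffAut.IsMTransitiveOn G m O) ∧
    (∀ O : Set X, AffAut.IsOpenOrbit Gbar O →
      AffAut.IsInfTransitiveOn Gbar O → AffAut.IsInfTransitiveOn G O) := by
  have hle : G ≤ Gbar := by
    rcases hGbar with rfl | rfl
    · exact AffAut.le_indClosure G
    · exact AffAut.subset_limClosureSet _
  -- Both versions of the closure lie between `G` and `indClosure G`, so the larger group suffices.
  have hge : Gbar ≤ AffAut.indClosure G := by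
    rcases hGbar with rfl | rfl
    · exact le_rfl
    · exact AffAut.limClosureSet_subset_indClosureSet _
  have key : ∀ (m : ℕ) (α : AffAut.Aut X), α ∈ Gbar → ∀ P : Fin m → X,
      ∃ g ∈ G, ∀ i, g • P i = α • P i := fun m α hα P => by
    obtain ⟨g, hg⟩ := AffAut.smul_mem_orbit_of_mem_indClosure hX hG (hge hα) P
    exact ⟨g.1, g.2, congrFun hg⟩
  have horbit : ∀ x : X, MulAction.orbit G x = MulAction.orbit Gbar x := by
    refine fun x => Set.Subset.antisymm ?_ ?_
    · rintro _ ⟨g, rfl⟩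
      exact ⟨⟨g.1, hle g.2⟩, rfl⟩
    · rintro _ ⟨α, rfl⟩
      -- A point is treated as a tuple of length one.
      obtain ⟨g, hg, h⟩ := key 1 α.1 α.2 fun _ => x
      exact ⟨⟨g, hg⟩, h 0⟩
  have htrans : ∀ (m : ℕ) (O : Set X),
      AffAut.IsMTransitiveOn Gbar m O → AffAut.IsMTransitiveOn G m O := by
    intro m O h P Q hP hQ hPO hQO
    obtain ⟨α, hα, hαP⟩ := h P Q hP hQ hPO hQO
    obtain ⟨g, hg, hgP⟩ := key m α hα P
    exact ⟨g, hg, fun i => (hgP i).trans (hαP i)⟩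
  refine ⟨⟨horbit, fun O => ?_⟩, fun O _ m _ => htrans m O, fun O _ h m hm => htrans m O (h m hm)⟩
  simp only [AffAut.IsOpenOrbit, horbit]
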